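/- All graphs are finite and simple. For a graph $G$ with adjacency matrix $A(G)$ let $f_G(x)=\det(xI-A(G))\in\mathbb Z[x]$; its zeros are the eigenvalues of $G$, and $\lambda_1(G)$ denotes the largest one. $G$ is called \emph{quadratic} if every eigenvalue of $G$ is an algebraic integer of degree at most two. For integers $n_1,\dots,n_k\ge 0$ let $T_{n_1,\dots,n_k}$ be the tree with a center vertex $u$ such that $T-u$ is the disjoint union of $n_i$ copies of the path $P_i$ on $i$ vertices ($1\le i\le k$), each attached to $u$ by one of its end vertices; a \emph{starlike tree} is a graph isomorphic to some $T_{n_1,\dots,n_k}$. For a starlike tree $T$, we say that $f_T(x)$ is of form (I) if $$f_T(x)=x^{t_1}(x^2-1)^{t_2}(x^2-2)^{t_3}\big((x^2-x-1)(x^2+x-1)\big)^{t_4}(x^2-3)^{t_5}(x^2-c)$$ for some integers $c\ge 4$ and $t_1,\dots,t_5\ge 0$, and $\lambda_1(T)$ is a root of $x^2-c$. \textbf{Theorem.} Let $T$ be a quadratic starlike tree that contains $K_{1,3}$ as a proper induced subgraph. Then $f_T(x)$ is of form (I) if and only if $T$ is isomorphic to one of $$T_{1,1,0,0,n_5}\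 (n_5\ge1),\qquad T_{1,0,n_3}\ (n_3\ge2),\qquad T_{0,n_2}\ (n_2\ge3),\qquad T_{n_1}\ (n_1\ge4).$$ Moreover, each of these trees is quadratic and contains $K_{1,3}$ as a proper induced subgraph, and their characteristic polynomials are \begin{align*} f_{T_{1,1,0,0,n_5}}(x)&=x^{n_5}(x^2-1)^{n_5}(x^2-x-1)(x^2+x-1)(x^2-3)^{n_5-1}\big(x^2-(n_5+3)\big) && (n_5\ge 1),\\ f_{T_{1,0,n_3}}(x)&=x^{n_3}(x^2-1)(x^2-2)^{n_3-1}\big(x^2-(n_3+2)\big) && (n_3\ge 2),\\ f_{T_{0,n_2}}(x)&=x(x^2-1)^{n_2-1}\big(x^2-(n_2+1)\big) && (n_2\ge 3),\\ f_{T_{n_1}}(x)&=x^{n_1-1}(x^2-n_1) && (n_1\ge 4). \end{align*} -/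

import Mathlib

open Polynomial

/-- The starlike tree `T_{n₁, …, n_k}`, where `n i` stands for `n_{i+1}`. The center is `none`.
For `i : Fin k` there are `n i` pendant paths with `i + 1` vertices each; the vertex
`some ⟨i, j, m⟩` is the `m`-th one (counted from the center, starting at `0`) on the `j`-th of these
paths. The center is joined to the vertices with `m = 0`, and on each path consecutive vertices
are joined. -/
def starlikeTree {k : ℕ} (n : Fin k → ℕ) :
    SimpleGraph (Option (Σ i : Fin k, Fin (n i) × Fin ((i : ℕ) + 1))) :=
  SimpleGraph.fromRel fun v w =>
    (v = none ∧ ∃ i j, w = some ⟨i, j, 0⟩) ∨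
    (∃ i j m m', v = some ⟨i, j, m⟩ ∧ w = some ⟨i, j, m'⟩ ∧ (m' : ℕ) = (m : ℕ) + 1)

/-- A graph is a starlike tree if it is, up to isomorphism, one of the `T_{n₁, …, n_k}`. -/
def IsStarlikeTree {V : Type*} (G : SimpleGraph V) : Prop :=
  ∃ (k : ℕ) (n : Fin k → ℕ), Nonempty (G ≃g starlikeTree n)

/-- `G` contains the star `K_{1,3}` as a proper induced subgraph. -/
def ProperlyContainsClaw {V : Type*} (G : SimpleGraph V) : Prop :=
  ∃ f : completeBipartiteGraph (Fin 1) (Fin 3) ↪g G, ¬ Function.Surjective f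

open Classical in
/-- The characteristic polynomial `det (x I - A(G))` of a finite graph. -/
noncomputable def graphCharpoly {V : Type*} [Fintype V] (G : SimpleGraph V) : ℤ[X] :=
  (G.adjMatrix ℤ).charpoly

/-- The set of eigenvalues of a finite graph: the zeros of its characteristic polynomial
(all of them are real). -/
def graphEigenvalues {V : Type*} [Fintype V] (G : SimpleGraph V) : Set ℝ :=
  {μ | aeval μ (graphCharpoly G) = 0}

/-- A graph is quadratic if its eigenvalues are algebraic integers of degree at most two. -/
def IsQuadraticGraph {V : Type*} [Fintype V] (G : SimpleGraph V) : Prop :=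
  ∀ μ ∈ graphEigenvalues G, IsIntegral ℤ μ ∧ (minpoly ℤ μ).natDegree ≤ 2

/-- The characteristic polynomial of `G` has form (I): it is
`x^{t₁} (x²-1)^{t₂} (x²-2)^{t₃} ((x²-x-1)(x²+x-1))^{t₄} (x²-3)^{t₅} (x²-c)` with integers
`c ≥ 4` and `t₁, …, t₅ ≥ 0`, and the largest eigenvalue of `G` is a root of `x² - c`. -/
def HasFormI {V : Type*} [Fintype V] (G : SimpleGraph V) : Prop :=
  ∃ (c : ℤ) (t₁ t₂ t₃ t₄ t₅ : ℕ), 4 ≤ c ∧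
    graphCharpoly G =
      X ^ t₁ * (X ^ 2 - 1) ^ t₂ * (X ^ 2 - 2) ^ t₃ * ((X ^ 2 - X - 1) * (X ^ 2 + X - 1)) ^ t₄ *
        (X ^ 2 - 3) ^ t₅ * (X ^ 2 - C c) ∧
    ∃ l : ℝ, IsGreatest (graphEigenvalues G) l ∧ aeval l (X ^ 2 - C c : ℤ[X]) = 0

/-! Write p_j for `pathEval x j`. Eliminating along the arms gives, for real x ≥ 2, f_T(x) = (x - Σ
n_i p_{i+1}/p_{i+2}) ∏ p_{i+2}^{n_i}, with i + 1 the number of vertices of an arm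
(`aeval_graphCharpoly_starlikeTree`). Evaluated on the infinite set x ≥ 2, this yields the four
characteristic polynomials, and from them form (I) and quadraticity.

Conversely, form (I) makes x = √c ≥ 2 an eigenvalue. The p_{i+2} are positive there, so the first
factor vanishes. Multiplied by x, it says Σ n_i e_i = c - d, where d is the degree of the center and
e_i = p_i/p_{i+2} is `armExcess`. The e_i start at e_0 = 0, increase strictly, and stay below
1/(c-3); as c and d are integers, c = d or c = d + 1 (`degree_eq_or_of_sum_armExcess`).

If c = d, all excesses vanish and T is a star. If c = d + 1, then d arms have total excess 1, with
e_1 = 1/d, e_2 = 1/(d-1) and e_4 = (1 - 1/d)/(d-2). Comparing averages leaves d arms of 2 vertices;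
or one of 1 and d-1 of 3; or one of 1, one of 2 and d-2 of 5 (`arm_counts_of_sum_eq_one`). The last
case needs a sharp upper bound on all e_i (`armExcess_lt_of_sq_eq`). -/

/-- The polynomials with `pathEval x (n + 1)` the value at `x` of the characteristic polynomial of
the path on `n` vertices. -/
def pathEval (x : ℝ) : ℕ → ℝ
  | 0 => 0
  | 1 => 1
  | n + 2 => x * pathEval x (n + 1) - pathEval x n

theorem pathEval_add_two (x : ℝ) (n : ℕ) :
    pathEval x (n + 2) = x * pathEval x (n + 1) - pathEval x n := rfl

theorem pathEval_lt_succ {x : ℝ} (hx : 2 ≤ x) (n : ℕ) :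
    0 ≤ pathEval x n ∧ pathEval x n < pathEval x (n + 1) := by
  induction n with
  | zero => simp [pathEval]
  | succ n ih =>
    refine ⟨ih.1.trans ih.2.le, ?_⟩
    rw [pathEval_add_two]
    nlinarith [ih.1, ih.2]

theorem pathEval_succ_pos {x : ℝ} (hx : 2 ≤ x) (n : ℕ) : 0 < pathEval x (n + 1) :=
  (pathEval_lt_succ hx n).1.trans_lt (pathEval_lt_succ hx n).2

theorem pathEval_pos {x : ℝ} (hx : 2 ≤ x) {n : ℕ} (hn : n ≠ 0) : 0 < pathEval x n := by
  obtain ⟨m, rfl⟩ := Nat.exists_eq_succ_of_ne_zero hn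
  exact pathEval_succ_pos hx m

/-! ### The determinant by elimination along the arms -/

/-- Entries between distinct indices of equal depth vanish too, so the matrix is block triangular
with diagonal blocks. -/
theorem Matrix.det_eq_prod_diag_of_depth {V R : Type*} [Fintype V] [DecidableEq V] [CommRing R]
    (M : Matrix V V R) (b : V → ℕ) (h : ∀ v w, v ≠ w → b w ≤ b v → M v w = 0) :
    M.det = ∏ v, M v v := by
  have hb : M.BlockTriangular b := fun v w hvw =>
    h v w (fun e => by simp [e] at hvw) hvw.le
  rw [hb.det, ← Finset.prod_fiberwise_of_maps_to (s := Finset.univ) (t := Finset.univ.image b)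
    (g := b) (fun v _ => Finset.mem_image_of_mem b (Finset.mem_univ v))]
  refine Finset.prod_congr rfl fun k _ => ?_
  have : M.toSquareBlock b k = Matrix.diagonal fun v : { v // b v = k } => M v v := by
    ext v w
    rw [Matrix.toSquareBlock_def, Matrix.of_apply, Matrix.diagonal_apply]
    split_ifs with hvw
    · rw [hvw]
    · exact h _ _ (fun e => hvw (Subtype.ext e)) (by rw [v.2, w.2])
  rw [this, Matrix.det_diagonal]
  exact (Finset.prod_subtype _ (by simp) fun v => M v v).symm

theorem graphCharpoly_eq {V : Type*} [Fintype V] [DecidableEq V] (G : SimpleGraph V)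
    [DecidableRel G.Adj] : graphCharpoly G = (G.adjMatrix ℤ).charpoly := by
  unfold graphCharpoly
  congr!

/-- The vertices of `starlikeTree n`. -/
abbrev StarlikeVertex {k : ℕ} (n : Fin k → ℕ) : Type :=
  Option (Σ i : Fin k, Fin (n i) × Fin ((i : ℕ) + 1))

section Tree
variable {k : ℕ} {n : Fin k → ℕ}

theorem starlikeTree_adj_none_some (i : Fin k) (j : Fin (n i)) (m : Fin ((i : ℕ) + 1)) :
    (starlikeTree n).Adj none (some ⟨i, j, m⟩) ↔ (m : ℕ) = 0 := by
  simp only [starlikeTree, SimpleGraph.fromRel_adj]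
  constructor
  · rintro ⟨-, (⟨-, i', j', h⟩ | ⟨_, _, _, _, h, _⟩) | (⟨h, _⟩ | ⟨_, _, _, _, _, h, _⟩)⟩
    · cases h; rfl
    all_goals cases h
  · intro h
    refine ⟨by simp, Or.inl (Or.inl ⟨trivial, i, j, ?_⟩)⟩
    obtain rfl : m = 0 := Fin.ext h
    rfl

theorem starlikeTree_adj_some_some (i : Fin k) (j : Fin (n i)) (m : Fin ((i : ℕ) + 1))
    (i' : Fin k) (j' : Fin (n i')) (m' : Fin ((i' : ℕ) + 1)) :
    (starlikeTree n).Adj (some ⟨i, j, m⟩) (some ⟨i', j', m'⟩) ↔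
      (i : ℕ) = i' ∧ (j : ℕ) = j' ∧ ((m' : ℕ) = m + 1 ∨ (m : ℕ) = m' + 1) := by
  simp only [starlikeTree, SimpleGraph.fromRel_adj]
  constructor
  · rintro ⟨-, (⟨h, _⟩ | ⟨_, _, _, _, h, h', e⟩) | (⟨h, _⟩ | ⟨_, _, _, _, h, h', e⟩)⟩
    · cases h
    · cases h; cases h'; exact ⟨rfl, rfl, Or.inl e⟩
    · cases h
    · cases h; cases h'; exact ⟨rfl, rfl, Or.inr e⟩
  · rintro ⟨h1, h2, h3⟩
    obtain rfl := Fin.ext h1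
    obtain rfl := Fin.ext h2
    refine ⟨fun e => ?_, ?_⟩
    · cases e; omega
    · rcases h3 with h3 | h3
      · exact Or.inl (Or.inr ⟨_, _, _, _, rfl, rfl, h3⟩)
      · exact Or.inr (Or.inr ⟨_, _, _, _, rfl, rfl, h3⟩)

/-- The distance from the center. -/
def starlikeDepth : StarlikeVertex n → ℕ
  | none => 0
  | some ⟨_, _, m⟩ => m + 1

/-- The unipotent matrix that makes `x I - A` triangular when multiplied from the right. -/
noncomputable def starlikeElim (x : ℝ) :
    Matrix (StarlikeVertex n) (StarlikeVertex n) ℝ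
  | none, none => 1
  | none, some _ => 0
  -- Each column solves the recurrence of (xI - A)v = 0 outward from its vertex: value 1 at the
  -- vertex, value 0 one step past the end of the arm.
  | some ⟨i, _, m⟩, none => pathEval x (i + 1 - m) / pathEval x (i + 2)
  | some ⟨i, j, m⟩, some ⟨i', j', m'⟩ =>
    if (i : ℕ) = i' ∧ (j : ℕ) = j' ∧ (m' : ℕ) ≤ m then
      pathEval x (i + 1 - m) / pathEval x (i + 1 - m') else 0

open Classical in
theorem sum_adjMatrix_none (f : StarlikeVertex n → ℝ) :
    ∑ z, (starlikeTree n).adjMatrix ℝ none z * f z = ∑ i, ∑ j, f (some ⟨i, j, 0⟩) := by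
  rw [Fintype.sum_option, Fintype.sum_sigma]
  simp only [SimpleGraph.adjMatrix_apply, SimpleGraph.irrefl, if_false, zero_mul, zero_add]
  refine Finset.sum_congr rfl fun i _ => ?_
  rw [Fintype.sum_prod_type]
  refine Finset.sum_congr rfl fun j _ => ?_
  rw [Finset.sum_eq_single 0]
  · rw [if_pos ((starlikeTree_adj_none_some i j 0).2 rfl), one_mul]
  · intro m _ hm
    rw [if_neg, zero_mul]
    rw [starlikeTree_adj_none_some]
    exact fun h => hm (Fin.ext h)
  · simp

/-- The argument of `g` is the depth: position t on an arm has depth t + 1. The value 0 at depth i +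
2, one past the end, lets the last vertex obey the same formula as the others. The center, at depth
0, is not in this sum, hence the `if`. -/
theorem sum_range_neighbors (g : ℕ → ℝ) {i m : ℕ} (hm : m < i + 1) (hg : g (i + 2) = 0) :
    ∑ t ∈ Finset.range (i + 1), (if t = m + 1 ∨ m = t + 1 then g (t + 1) else 0) =
      (if m = 0 then 0 else g m) + g (m + 2) := by
  have h : ∀ t ∈ Finset.range (i + 1), (if t = m + 1 ∨ m = t + 1 then g (t + 1) else 0) =
      (if t = m - 1 then (if m = 0 then 0 else g m) else 0) +
        (if t = m + 1 then g (m + 2) else 0) := by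
    intro t _
    by_cases h1 : t = m + 1
    · have : t ≠ m - 1 := by omega
      rw [if_pos (Or.inl h1), if_neg this, if_pos h1, h1, zero_add]
    · by_cases h2 : m = t + 1
      · have h3 : t = m - 1 := by omega
        rw [if_pos (Or.inr h2), if_neg h1, if_pos h3, if_neg (by omega), add_zero, h2]
      · rw [if_neg (by omega), if_neg h1]
        split_ifs <;> first | omega | simp
  rw [Finset.sum_congr rfl h, Finset.sum_add_distrib, Finset.sum_ite_eq', Finset.sum_ite_eq',
    if_pos (Finset.mem_range.2 (by omega))]
  congr 1
  split_ifs with h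
  · rfl
  · rw [Finset.mem_range] at h
    rw [show m = i by omega, hg]

open Classical in
theorem sum_adjMatrix_some (f : StarlikeVertex n → ℝ)
    (i : Fin k) (j : Fin (n i)) (m : Fin ((i : ℕ) + 1)) (g : ℕ → ℝ) (hg0 : f none = g 0)
    (hg : ∀ t : Fin ((i : ℕ) + 1), f (some ⟨i, j, t⟩) = g (t + 1)) (hg2 : g (i + 2) = 0) :
    ∑ z, (starlikeTree n).adjMatrix ℝ (some ⟨i, j, m⟩) z * f z = g m + g (m + 2) := by
  rw [Fintype.sum_option, Fintype.sum_sigma, Finset.sum_eq_single i, Fintype.sum_prod_type,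
    Finset.sum_eq_single j]
  · have h1 : ∀ t : Fin ((i : ℕ) + 1),
        (starlikeTree n).adjMatrix ℝ (some ⟨i, j, m⟩) (some ⟨i, j, t⟩) * f (some ⟨i, j, t⟩) =
        if (t : ℕ) = m + 1 ∨ (m : ℕ) = t + 1 then g (t + 1) else 0 := by
      intro t
      rw [SimpleGraph.adjMatrix_apply, starlikeTree_adj_some_some, hg, ite_mul, one_mul, zero_mul]
      simp
    rw [Finset.sum_congr rfl fun t _ => h1 t,
      Fin.sum_univ_eq_sum_range (fun t => if t = m + 1 ∨ (m : ℕ) = t + 1 then g (t + 1) else 0),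
      sum_range_neighbors g m.2 hg2, ← add_assoc]
    congr 1
    rw [SimpleGraph.adjMatrix_apply, SimpleGraph.adj_comm, starlikeTree_adj_none_some, hg0]
    by_cases h : (m : ℕ) = 0
    · rw [if_pos h, if_pos h, h]; simp
    · rw [if_neg h, if_neg h]; simp
  · intro j' _ hj
    refine Finset.sum_eq_zero fun t _ => ?_
    rw [SimpleGraph.adjMatrix_apply, if_neg, zero_mul]
    rw [starlikeTree_adj_some_some]
    exact fun h => hj (Fin.ext h.2.1.symm)
  · simp
  · intro i' _ hi
    refine Finset.sum_eq_zero fun t _ => ?_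
    obtain ⟨j', t⟩ := t
    rw [SimpleGraph.adjMatrix_apply, if_neg, zero_mul]
    rw [starlikeTree_adj_some_some]
    exact fun h => hi (Fin.ext h.1.symm)
  · simp

theorem det_starlikeElim {x : ℝ} (hx : 2 ≤ x) :
    (starlikeElim x : Matrix (StarlikeVertex n) _ ℝ).det
      = 1 := by
  rw [← Matrix.det_transpose, Matrix.det_eq_prod_diag_of_depth _ starlikeDepth]
  · refine Finset.prod_eq_one fun v _ => ?_
    rcases v with _ | ⟨i, j, m⟩
    · rfl
    · simp only [Matrix.transpose_apply, starlikeElim, le_refl, and_self, if_true]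
      exact div_self (pathEval_pos hx (by omega)).ne'
  · rintro (_ | ⟨i, j, m⟩) (_ | ⟨i', j', m'⟩) h hd
    · exact absurd rfl h
    · simp [starlikeDepth] at hd
    · rfl
    · simp only [starlikeDepth] at hd
      simp only [Matrix.transpose_apply, starlikeElim]
      rw [if_neg]
      rintro ⟨h1, h2, h3⟩
      obtain rfl := Fin.ext h1
      obtain rfl := Fin.ext h2
      obtain rfl : m = m' := Fin.ext (by omega)
      exact h rfl

open Classical in
theorem mul_starlikeElim_some_none {x : ℝ} (hx : 2 ≤ x) (i : Fin k) (j : Fin (n i))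
    (m : Fin ((i : ℕ) + 1)) :
    ((Matrix.scalar _ x - (starlikeTree n).adjMatrix ℝ) * starlikeElim x :
      Matrix (StarlikeVertex n) (StarlikeVertex n) ℝ) (some ⟨i, j, m⟩) none
      = 0 := by
  rw [sub_mul, Matrix.sub_apply, Matrix.scalar_apply, Matrix.diagonal_mul, Matrix.mul_apply,
    sum_adjMatrix_some _ i j m (fun t => pathEval x (i + 2 - t) / pathEval x (i + 2))]
  -- r is the number of vertices beyond m on the arm; the claim becomes the recurrence for p_{r+2}.
  · obtain ⟨r, hr⟩ : ∃ r, (i : ℕ) = m + r := ⟨i - m, by omega⟩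
    simp only [starlikeElim]
    rw [show (i : ℕ) + 1 - m = r + 1 by omega, show (i : ℕ) + 2 - m = r + 2 by omega,
      show (i : ℕ) + 2 - (m + 2) = r by omega, pathEval_add_two x r]
    ring
  · simp only [starlikeElim]
    exact (div_self (pathEval_succ_pos hx _).ne').symm
  · intro t
    simp only [starlikeElim]
    rw [show (i : ℕ) + 2 - (t + 1) = i + 1 - t by omega]
  · simp [pathEval]

open Classical in
theorem mul_starlikeElim_some_some {x : ℝ} (i : Fin k) (j : Fin (n i))
    (m : Fin ((i : ℕ) + 1)) (i' : Fin k) (j' : Fin (n i')) (m' : Fin ((i' : ℕ) + 1))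
    (h : (m' : ℕ) ≤ m) :
    ((Matrix.scalar _ x - (starlikeTree n).adjMatrix ℝ) * starlikeElim x :
      Matrix (StarlikeVertex n) (StarlikeVertex n) ℝ) (some ⟨i, j, m⟩)
      (some ⟨i', j', m'⟩) = if (i : ℕ) = i' ∧ (j : ℕ) = j' ∧ (m : ℕ) = m' then
        pathEval x (i + 2 - m) / pathEval x (i + 1 - m) else 0 := by
  rw [sub_mul, Matrix.sub_apply, Matrix.scalar_apply, Matrix.diagonal_mul, Matrix.mul_apply,
    sum_adjMatrix_some _ i j m (fun t => if (i : ℕ) = i' ∧ (j : ℕ) = j' ∧ (m' : ℕ) + 1 ≤ t then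
      pathEval x (i + 2 - t) / pathEval x (i + 1 - m') else 0)]
  · obtain ⟨r, hr⟩ : ∃ r, (i : ℕ) = m + r := ⟨i - m, by omega⟩
    simp only [starlikeElim]
    rw [show (i : ℕ) + 1 - m = r + 1 by omega, show (i : ℕ) + 2 - m = r + 2 by omega,
      show (i : ℕ) + 2 - (m + 2) = r by omega, pathEval_add_two x r]
    by_cases hij : (i : ℕ) = i' ∧ (j : ℕ) = j'
    · simp only [hij.1, hij.2, true_and]
      rw [if_pos h, if_pos (show (m' : ℕ) + 1 ≤ m + 2 by omega)]
      split_ifs with h1 h2 h2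
      · omega
      · ring
      · rw [← h2, ← hij.1, show (i : ℕ) + 1 - m = r + 1 by omega]
        ring
      · omega
    · rw [if_neg (fun h => hij ⟨h.1, h.2.1⟩), if_neg (fun h => hij ⟨h.1, h.2.1⟩),
        if_neg (fun h => hij ⟨h.1, h.2.1⟩), if_neg (fun h => hij ⟨h.1, h.2.1⟩)]
      ring
  · simp [starlikeElim]
  · intro t
    simp only [starlikeElim]
    rw [show (i : ℕ) + 2 - (t + 1) = i + 1 - t by omega]
    simp only [Nat.add_le_add_iff_right]
  · simp [pathEval]

/-- Telescoping from the outer end of the arm, where p_1 = 1. -/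
theorem prod_pathEval_div {x : ℝ} (hx : 2 ≤ x) (i : ℕ) :
    ∏ m : Fin (i + 1), pathEval x (i + 2 - m) / pathEval x (i + 1 - m) = pathEval x (i + 2) := by
  rw [Fin.prod_univ_eq_prod_range (fun m => pathEval x (i + 2 - m) / pathEval x (i + 1 - m)),
    ← Finset.prod_range_reflect]
  have h : ∀ t ∈ Finset.range (i + 1), pathEval x (i + 2 - (i + 1 - 1 - t)) /
      pathEval x (i + 1 - (i + 1 - 1 - t)) = pathEval x (t + 1 + 1) / pathEval x (t + 1) := by
    intro t ht
    rw [Finset.mem_range] at ht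
    rw [show i + 2 - (i + 1 - 1 - t) = t + 1 + 1 by omega,
      show i + 1 - (i + 1 - 1 - t) = t + 1 by omega]
  rw [Finset.prod_congr rfl h]
  clear h
  induction i with
  | zero => simp [pathEval]
  | succ i ih =>
    rw [Finset.prod_range_succ, ih]
    have := (pathEval_succ_pos hx (i + 1)).ne'
    field_simp

open Classical in
-- `starlikeElim` has determinant 1 and makes the matrix triangular by depth. The center contributes
-- the first factor, and each arm contributes its telescoping product.
theorem det_scalar_sub_adjMatrix_starlikeTree {x : ℝ} (hx : 2 ≤ x) (n : Fin k → ℕ) :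
    (Matrix.scalar _ x - (starlikeTree n).adjMatrix ℝ).det =
      (x - ∑ i, n i * (pathEval x (i + 1) / pathEval x (i + 2))) *
        ∏ i : Fin k, pathEval x (i + 2) ^ n i := by
  rw [← mul_one (Matrix.det _), ← det_starlikeElim (n := n) hx, ← Matrix.det_mul,
    Matrix.det_eq_prod_diag_of_depth _ starlikeDepth, Fintype.prod_option, Fintype.prod_sigma]
  · congr 1
    · rw [sub_mul, Matrix.sub_apply, Matrix.scalar_apply, Matrix.diagonal_mul, Matrix.mul_apply,
        sum_adjMatrix_none]
      simp [starlikeElim]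
    · refine Finset.prod_congr rfl fun i _ => ?_
      rw [Fintype.prod_prod_type]
      have h : ∀ j : Fin (n i), ∏ m : Fin ((i : ℕ) + 1),
          ((Matrix.scalar _ x - (starlikeTree n).adjMatrix ℝ) * starlikeElim x :
      Matrix (StarlikeVertex n) (StarlikeVertex n) ℝ)
            (some ⟨i, j, m⟩) (some ⟨i, j, m⟩) = pathEval x (i + 2) := by
        intro j
        rw [← prod_pathEval_div hx]
        refine Finset.prod_congr rfl fun m _ => ?_
        rw [mul_starlikeElim_some_some _ _ _ _ _ _ le_rfl, if_pos ⟨rfl, rfl, rfl⟩]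
      rw [Finset.prod_congr rfl fun j _ => h j]
      simp
  · rintro (_ | ⟨i, j, m⟩) (_ | ⟨i', j', m'⟩) h hd
    · exact absurd rfl h
    · simp [starlikeDepth] at hd
    · exact mul_starlikeElim_some_none hx i j m
    · simp only [starlikeDepth, Nat.add_le_add_iff_right] at hd
      rw [mul_starlikeElim_some_some _ _ _ _ _ _ hd, if_neg]
      rintro ⟨h1, h2, h3⟩
      obtain rfl := Fin.ext h1
      obtain rfl := Fin.ext h2
      obtain rfl := Fin.ext h3
      exact h rfl

theorem aeval_graphCharpoly_starlikeTree {x : ℝ} (hx : 2 ≤ x) (n : Fin k → ℕ) :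
    aeval x (graphCharpoly (starlikeTree n)) =
      (x - ∑ i, n i * (pathEval x (i + 1) / pathEval x (i + 2))) *
        ∏ i : Fin k, pathEval x (i + 2) ^ n i := by
  classical
  rw [← det_scalar_sub_adjMatrix_starlikeTree hx, ← Matrix.eval_charpoly, graphCharpoly_eq,
    Polynomial.aeval_def, Polynomial.eval₂_eq_eval_map, ← Matrix.charpoly_map]
  congr 2
  ext v w
  simp only [Matrix.map_apply, SimpleGraph.adjMatrix_apply]
  split_ifs <;> simp_all

end Tree

/-! ### Isomorphisms and arm counts -/

/-- The map between starlike trees that keeps the coordinates of each vertex. -/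
def starlikeMap {k l : ℕ} {n : Fin k → ℕ} {p : Fin l → ℕ}
    (h : ∀ i : Fin k, n i ≠ 0 → ∃ hi : (i : ℕ) < l, p ⟨i, hi⟩ = n i) :
    StarlikeVertex n → StarlikeVertex p
  | none => none
  | some ⟨i, j, m⟩ =>
    some ⟨⟨i, (h i j.pos.ne').1⟩, ⟨j, j.2.trans_eq (h i j.pos.ne').2.symm⟩, ⟨m, m.2⟩⟩

/-- Trailing zero counts carry no vertices, so trees with different k can be compared. -/
theorem starlikeTree_iso_of_counts {k l : ℕ} (n : Fin k → ℕ) (p : Fin l → ℕ)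
    (h : ∀ i : ℕ, (if hi : i < k then n ⟨i, hi⟩ else 0) = if hi : i < l then p ⟨i, hi⟩ else 0) :
    Nonempty (starlikeTree n ≃g starlikeTree p) := by
  have h1 : ∀ i : Fin k, n i ≠ 0 → ∃ hi : (i : ℕ) < l, p ⟨i, hi⟩ = n i := by
    intro i hn
    have := h i
    rw [dif_pos i.2] at this
    split_ifs at this with hi
    · exact ⟨hi, this.symm⟩
    · exact absurd this hn
  have h2 : ∀ i : Fin l, p i ≠ 0 → ∃ hi : (i : ℕ) < k, n ⟨i, hi⟩ = p i := by
    intro i hp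
    have := h i
    rw [dif_pos i.2] at this
    split_ifs at this with hi
    · exact ⟨hi, this⟩
    · exact absurd this.symm hp
  refine ⟨⟨⟨starlikeMap h1, starlikeMap h2, ?_, ?_⟩, ?_⟩⟩
  · rintro (_ | ⟨i, j, m⟩) <;> rfl
  · rintro (_ | ⟨i, j, m⟩) <;> rfl
  · rintro (_ | ⟨i, j, m⟩) (_ | ⟨i', j', m'⟩)
    · simp [starlikeMap]
    · simp only [Equiv.coe_fn_mk, starlikeMap, starlikeTree_adj_none_some]
    · simp only [Equiv.coe_fn_mk, starlikeMap]
      rw [SimpleGraph.adj_comm, starlikeTree_adj_none_some, SimpleGraph.adj_comm,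
        starlikeTree_adj_none_some]
    · simp only [Equiv.coe_fn_mk, starlikeMap, starlikeTree_adj_some_some]

theorem graphCharpoly_congr {V W : Type*} [Fintype V] [Fintype W] {G : SimpleGraph V}
    {H : SimpleGraph W} (e : G ≃g H) : graphCharpoly G = graphCharpoly H := by
  classical
  unfold graphCharpoly
  rw [← Matrix.charpoly_reindex e.toEquiv]
  congr 1
  ext v w
  simp only [Matrix.reindex_apply, Matrix.submatrix_apply, SimpleGraph.adjMatrix_apply]
  have := e.map_adj_iff (v := e.symm v) (w := e.symm w)
  simp only [RelIso.apply_symm_apply] at this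
  exact if_congr this.symm rfl rfl

/-! ### Characteristic polynomials of the four families -/

theorem intPoly_eq_of_aeval_eq {f g : ℤ[X]} (h : ∀ x : ℝ, 2 ≤ x → aeval x f = aeval x g) :
    f = g := by
  have hinj : Function.Injective (Int.castRingHom ℝ) := Int.cast_injective
  refine Polynomial.map_injective _ hinj (Polynomial.eq_of_infinite_eval_eq _ _ ?_)
  refine (Set.Ici_infinite (2 : ℝ)).mono fun x hx => ?_
  have := h x hx
  rwa [Polynomial.aeval_def, Polynomial.aeval_def, Polynomial.eval₂_eq_eval_map,
    Polynomial.eval₂_eq_eval_map] at this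

theorem pathEval_values (x : ℝ) : pathEval x 0 = 0 ∧ pathEval x 1 = 1 ∧ pathEval x 2 = x ∧
    pathEval x 3 = x ^ 2 - 1 ∧ pathEval x 4 = x * (x ^ 2 - 2) ∧
    pathEval x 5 = (x ^ 2 - x - 1) * (x ^ 2 + x - 1) ∧
    pathEval x 6 = x * (x ^ 2 - 1) * (x ^ 2 - 3) := by
  simp only [pathEval]
  refine ⟨trivial, trivial, ?_, ?_, ?_, ?_, ?_⟩ <;> ring

theorem graphCharpoly_star {a : ℕ} (ha : 1 ≤ a) :
    graphCharpoly (starlikeTree ![a]) = X ^ (a - 1) * (X ^ 2 - C (a : ℤ)) := by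
  obtain ⟨b, rfl⟩ := Nat.exists_eq_add_of_le' ha
  refine intPoly_eq_of_aeval_eq fun x hx => ?_
  obtain ⟨h0, h1, h2, h3, h4, h5, h6⟩ := pathEval_values x
  rw [aeval_graphCharpoly_starlikeTree hx]
  have : x ≠ 0 := by positivity
  simp [h1, h2]
  field_simp
  ring

theorem graphCharpoly_arms_two {a : ℕ} (ha : 1 ≤ a) :
    graphCharpoly (starlikeTree ![0, a]) =
      X * (X ^ 2 - 1) ^ (a - 1) * (X ^ 2 - C ((a : ℤ) + 1)) := by
  obtain ⟨b, rfl⟩ := Nat.exists_eq_add_of_le' ha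
  refine intPoly_eq_of_aeval_eq fun x hx => ?_
  obtain ⟨h0, h1, h2, h3, h4, h5, h6⟩ := pathEval_values x
  rw [aeval_graphCharpoly_starlikeTree hx]
  have hx0 : x ≠ 0 := by positivity
  have hx1 : x ^ 2 - 1 ≠ 0 := by nlinarith
  simp [Fin.sum_univ_succ, Fin.prod_univ_succ, h1, h2, h3]
  field_simp
  ring

theorem aeval_two (x : ℝ) : aeval x (2 : ℤ[X]) = 2 := map_ofNat _ 2

theorem aeval_three (x : ℝ) : aeval x (3 : ℤ[X]) = 3 := map_ofNat _ 3

theorem graphCharpoly_arms_one_three {a : ℕ} (ha : 1 ≤ a) :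
    graphCharpoly (starlikeTree ![1, 0, a]) =
      X ^ a * (X ^ 2 - 1) * (X ^ 2 - 2) ^ (a - 1) * (X ^ 2 - C ((a : ℤ) + 2)) := by
  obtain ⟨b, rfl⟩ := Nat.exists_eq_add_of_le' ha
  refine intPoly_eq_of_aeval_eq fun x hx => ?_
  obtain ⟨h0, h1, h2, h3, h4, h5, h6⟩ := pathEval_values x
  rw [aeval_graphCharpoly_starlikeTree hx]
  have hx0 : x ≠ 0 := by positivity
  have hx1 : x ^ 2 - 2 ≠ 0 := by nlinarith
  simp [Fin.sum_univ_succ, Fin.prod_univ_succ, h1, h2, h3, h4, aeval_two, mul_pow]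
  field_simp
  ring

theorem graphCharpoly_arms_one_two_five {a : ℕ} (ha : 1 ≤ a) :
    graphCharpoly (starlikeTree ![1, 1, 0, 0, a]) =
      X ^ a * (X ^ 2 - 1) ^ a * (X ^ 2 - X - 1) * (X ^ 2 + X - 1) *
        (X ^ 2 - 3) ^ (a - 1) * (X ^ 2 - C ((a : ℤ) + 3)) := by
  obtain ⟨b, rfl⟩ := Nat.exists_eq_add_of_le' ha
  refine intPoly_eq_of_aeval_eq fun x hx => ?_
  obtain ⟨h0, h1, h2, h3, h4, h5, h6⟩ := pathEval_values x
  rw [aeval_graphCharpoly_starlikeTree hx]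
  have hx0 : x ≠ 0 := by positivity
  have hx1 : x ^ 2 - 1 ≠ 0 := by nlinarith
  have hx3 : x ^ 2 - 3 ≠ 0 := by nlinarith
  simp [Fin.sum_univ_succ, Fin.prod_univ_succ, h1, h2, h3, h4, h5, h6, aeval_three, mul_pow]
  field_simp
  ring

/-! ### Consequences of form (I) -/

section FormI
variable {V : Type*} [Fintype V] {G : SimpleGraph V} {c : ℤ} {t₁ t₂ t₃ t₄ t₅ : ℕ}

theorem eigenvalue_cases_of_charpoly_eq
    (h : graphCharpoly G =
      X ^ t₁ * (X ^ 2 - 1) ^ t₂ * (X ^ 2 - 2) ^ t₃ * ((X ^ 2 - X - 1) * (X ^ 2 + X - 1)) ^ t₄ *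
        (X ^ 2 - 3) ^ t₅ * (X ^ 2 - C c)) {μ : ℝ} (hμ : μ ∈ graphEigenvalues G) :
    μ = 0 ∨ μ ^ 2 - 1 = 0 ∨ μ ^ 2 - 2 = 0 ∨ μ ^ 2 - μ - 1 = 0 ∨ μ ^ 2 + μ - 1 = 0 ∨
      μ ^ 2 - 3 = 0 ∨ μ ^ 2 - c = 0 := by
  rw [graphEigenvalues, Set.mem_ofPred_eq, h] at hμ
  simp only [map_mul, map_pow, map_sub, map_add, aeval_X, aeval_two, aeval_three, map_one, mul_eq_zero,
    eq_intCast, map_intCast] at hμ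
  rcases hμ with ((((h | h) | h) | h) | h) | h
  · exact Or.inl (eq_zero_of_pow_eq_zero h)
  · exact Or.inr (Or.inl (eq_zero_of_pow_eq_zero h))
  · exact Or.inr (Or.inr (Or.inl (eq_zero_of_pow_eq_zero h)))
  · rcases mul_eq_zero.1 (eq_zero_of_pow_eq_zero h) with h | h <;> simp [h]
  · exact Or.inr (Or.inr (Or.inr (Or.inr (Or.inr (Or.inl (eq_zero_of_pow_eq_zero h))))))
  · exact Or.inr (Or.inr (Or.inr (Or.inr (Or.inr (Or.inr h)))))

theorem isIntegral_and_natDegree_minpoly_le_two {μ : ℝ} (b e : ℤ) (h : μ ^ 2 + b * μ + e = 0) :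
    IsIntegral ℤ μ ∧ (minpoly ℤ μ).natDegree ≤ 2 := by
  have hm : (X ^ 2 + C b * X + C e : ℤ[X]).Monic := by monicity!
  have hd : (X ^ 2 + C b * X + C e : ℤ[X]).natDegree ≤ 2 := by compute_degree
  have hr : aeval μ (X ^ 2 + C b * X + C e : ℤ[X]) = 0 := by simpa using h
  exact ⟨⟨_, hm, hr⟩, (natDegree_le_natDegree (minpoly.min ℤ μ hm hr)).trans hd⟩

theorem isQuadraticGraph_of_charpoly_eq
    (h : graphCharpoly G =
      X ^ t₁ * (X ^ 2 - 1) ^ t₂ * (X ^ 2 - 2) ^ t₃ * ((X ^ 2 - X - 1) * (X ^ 2 + X - 1)) ^ t₄ *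
        (X ^ 2 - 3) ^ t₅ * (X ^ 2 - C c)) : IsQuadraticGraph G := by
  intro μ hμ
  rcases eigenvalue_cases_of_charpoly_eq h hμ with h | h | h | h | h | h | h
  · exact isIntegral_and_natDegree_minpoly_le_two 0 0 (by simp [h])
  · exact isIntegral_and_natDegree_minpoly_le_two 0 (-1) (by push_cast; linarith)
  · exact isIntegral_and_natDegree_minpoly_le_two 0 (-2) (by push_cast; linarith)
  · exact isIntegral_and_natDegree_minpoly_le_two (-1) (-1) (by push_cast; linarith)
  · exact isIntegral_and_natDegree_minpoly_le_two 1 (-1) (by push_cast; linarith)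
  · exact isIntegral_and_natDegree_minpoly_le_two 0 (-3) (by push_cast; linarith)
  · exact isIntegral_and_natDegree_minpoly_le_two 0 (-c) (by push_cast; linarith)

theorem hasFormI_of_charpoly_eq (hc : 4 ≤ c)
    (h : graphCharpoly G =
      X ^ t₁ * (X ^ 2 - 1) ^ t₂ * (X ^ 2 - 2) ^ t₃ * ((X ^ 2 - X - 1) * (X ^ 2 + X - 1)) ^ t₄ *
        (X ^ 2 - 3) ^ t₅ * (X ^ 2 - C c)) : HasFormI G := by
  have hc' : (4 : ℝ) ≤ c := by exact_mod_cast hc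
  have hs : √(c : ℝ) ^ 2 = c := Real.sq_sqrt (by linarith)
  have hs2 : 2 ≤ √(c : ℝ) := Real.le_sqrt_of_sq_le (by linarith)
  have hroot : aeval √(c : ℝ) (X ^ 2 - C c : ℤ[X]) = 0 := by simp [hs]
  refine ⟨c, t₁, t₂, t₃, t₄, t₅, hc, h, √(c : ℝ), ⟨?_, fun μ hμ => ?_⟩, hroot⟩
  · rw [graphEigenvalues, Set.mem_ofPred_eq, h, map_mul, hroot, mul_zero]
  -- Every root of the other factors is less than 2 ≤ √c.
  · by_contra! hlt
    rcases eigenvalue_cases_of_charpoly_eq h hμ with h | h | h | h | h | h | h <;> nlinarith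

end FormI

theorem charpoly_star_formI {a : ℕ} (ha : 1 ≤ a) : graphCharpoly (starlikeTree ![a]) =
      X ^ (a - 1) * (X ^ 2 - 1) ^ 0 * (X ^ 2 - 2) ^ 0 * ((X ^ 2 - X - 1) * (X ^ 2 + X - 1)) ^ 0 *
        (X ^ 2 - 3) ^ 0 * (X ^ 2 - C (a : ℤ)) := by
  rw [graphCharpoly_star ha]; ring

theorem charpoly_arms_two_formI {a : ℕ} (ha : 1 ≤ a) : graphCharpoly (starlikeTree ![0, a]) =
      X ^ 1 * (X ^ 2 - 1) ^ (a - 1) * (X ^ 2 - 2) ^ 0 *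
        ((X ^ 2 - X - 1) * (X ^ 2 + X - 1)) ^ 0 * (X ^ 2 - 3) ^ 0 *
        (X ^ 2 - C ((a : ℤ) + 1)) := by
  rw [graphCharpoly_arms_two ha]; ring

theorem charpoly_arms_one_three_formI {a : ℕ} (ha : 1 ≤ a) :
    graphCharpoly (starlikeTree ![1, 0, a]) =
      X ^ a * (X ^ 2 - 1) ^ 1 * (X ^ 2 - 2) ^ (a - 1) *
        ((X ^ 2 - X - 1) * (X ^ 2 + X - 1)) ^ 0 * (X ^ 2 - 3) ^ 0 *
        (X ^ 2 - C ((a : ℤ) + 2)) := by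
  rw [graphCharpoly_arms_one_three ha]; ring

theorem charpoly_arms_one_two_five_formI {a : ℕ} (ha : 1 ≤ a) :
    graphCharpoly (starlikeTree ![1, 1, 0, 0, a]) =
      X ^ a * (X ^ 2 - 1) ^ a * (X ^ 2 - 2) ^ 0 *
        ((X ^ 2 - X - 1) * (X ^ 2 + X - 1)) ^ 1 * (X ^ 2 - 3) ^ (a - 1) *
        (X ^ 2 - C ((a : ℤ) + 3)) := by
  rw [graphCharpoly_arms_one_two_five ha]; ring

theorem HasFormI.of_iso {V W : Type*} [Fintype V] [Fintype W] {G : SimpleGraph V}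
    {H : SimpleGraph W} (e : G ≃g H) (h : HasFormI H) : HasFormI G := by
  unfold HasFormI graphEigenvalues at *
  rwa [graphCharpoly_congr e]

/-! ### Induced claws -/

/-- The claw is the center with the first vertices of three distinct arms; `v` is a vertex it
misses. -/
theorem properlyContainsClaw_starlikeTree {k : ℕ} {n : Fin k → ℕ}
    (arm : Fin 3 → Σ i : Fin k, Fin (n i))
    (harm : ∀ a b, ((arm a).1 : ℕ) = (arm b).1 → ((arm a).2 : ℕ) = (arm b).2 → a = b)
    (v : Σ i : Fin k, Fin (n i) × Fin ((i : ℕ) + 1))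
    (hv : ∀ a, (v.1 : ℕ) = (arm a).1 → (v.2.1 : ℕ) = (arm a).2 → (v.2.2 : ℕ) ≠ 0) :
    ProperlyContainsClaw (starlikeTree n) := by
  let f : Fin 1 ⊕ Fin 3 → StarlikeVertex n :=
    Sum.elim (fun _ => none) (fun a => some ⟨(arm a).1, (arm a).2, 0⟩)
  have hf : Function.Injective f := by
    rintro (a | a) (b | b) h
    · exact congrArg _ (Subsingleton.elim a b)
    · cases h
    · cases h
    · have h' := Option.some.inj h
      exact congrArg _ (harm a b (congrArg (fun z => (z.1 : ℕ)) h')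
        (congrArg (fun z => (z.2.1 : ℕ)) h'))
  refine ⟨⟨⟨f, hf⟩, ?_⟩, ?_⟩
  · rintro (a | a) (b | b)
    · change (starlikeTree n).Adj none none ↔ _
      simp
    · change (starlikeTree n).Adj none (some ⟨(arm b).1, (arm b).2, 0⟩) ↔ _
      rw [starlikeTree_adj_none_some]
      simp
    · change (starlikeTree n).Adj (some ⟨(arm a).1, (arm a).2, 0⟩) none ↔ _
      rw [SimpleGraph.adj_comm, starlikeTree_adj_none_some]
      simp
    · change (starlikeTree n).Adj (some ⟨(arm a).1, (arm a).2, 0⟩)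
        (some ⟨(arm b).1, (arm b).2, 0⟩) ↔ _
      rw [starlikeTree_adj_some_some]
      simp
  · intro hs
    obtain ⟨a | a, h⟩ := hs (some v)
    · cases h
    · have h' := Option.some.inj h
      exact hv a (congrArg (fun z => (z.1 : ℕ)) h').symm
        (congrArg (fun z => (z.2.1 : ℕ)) h').symm (congrArg (fun z => (z.2.2 : ℕ)) h').symm

theorem properlyContainsClaw_star {a : ℕ} (ha : 4 ≤ a) :
    ProperlyContainsClaw (starlikeTree ![a]) :=
  properlyContainsClaw_starlikeTree (fun t => ⟨0, (⟨t, by omega⟩ : Fin a)⟩)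
    (fun _ _ _ h => Fin.ext h) ⟨0, (⟨3, by omega⟩ : Fin a), 0⟩
    (fun t _ h => absurd h (by simp only; omega))

theorem properlyContainsClaw_arms_two {a : ℕ} (ha : 3 ≤ a) :
    ProperlyContainsClaw (starlikeTree ![0, a]) :=
  properlyContainsClaw_starlikeTree (fun t => ⟨1, (⟨t, by omega⟩ : Fin a)⟩)
    (fun _ _ _ h => Fin.ext h) ⟨1, (⟨0, by omega⟩ : Fin a), (1 : Fin 2)⟩
    (fun _ _ _ => Nat.one_ne_zero)

theorem properlyContainsClaw_arms_one_three {a : ℕ} (ha : 2 ≤ a) :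
    ProperlyContainsClaw (starlikeTree ![1, 0, a]) :=
  properlyContainsClaw_starlikeTree
    ![⟨0, (0 : Fin 1)⟩, ⟨2, (⟨0, by omega⟩ : Fin a)⟩, ⟨2, (⟨1, by omega⟩ : Fin a)⟩]
    (fun s t => by fin_cases s <;> fin_cases t <;> simp)
    ⟨2, (⟨0, by omega⟩ : Fin a), (1 : Fin 3)⟩ (fun _ _ _ => Nat.one_ne_zero)

theorem properlyContainsClaw_arms_one_two_five {a : ℕ} (ha : 1 ≤ a) :
    ProperlyContainsClaw (starlikeTree ![1, 1, 0, 0, a]) :=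
  properlyContainsClaw_starlikeTree
    ![⟨0, (0 : Fin 1)⟩, ⟨1, (0 : Fin 1)⟩, ⟨4, (⟨0, by omega⟩ : Fin a)⟩]
    (fun s t => by fin_cases s <;> fin_cases t <;> simp)
    ⟨4, (⟨0, by omega⟩ : Fin a), (1 : Fin 5)⟩ (fun _ _ _ => Nat.one_ne_zero)

/-! ### The excess of an arm -/

/-- `x` times the contribution of an arm with `i + 1` vertices, minus `1`. -/
noncomputable def armExcess (x : ℝ) (i : ℕ) : ℝ := pathEval x i / pathEval x (i + 2)

section Excess
variable {x : ℝ}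

theorem mul_pathEval_div (hx : 2 ≤ x) (i : ℕ) :
    x * (pathEval x (i + 1) / pathEval x (i + 2)) = 1 + armExcess x i := by
  have h := (pathEval_succ_pos hx (i + 1)).ne'
  rw [armExcess, ← mul_div_assoc, eq_comm, ← div_self h, ← add_div]
  congr 1
  rw [pathEval_add_two]
  ring

theorem armExcess_zero (x : ℝ) : armExcess x 0 = 0 := by simp [armExcess, pathEval]

/-- All bounds and values below come from iterating the increasing map e ↦ (1 + e)/(x² - 1 - e) from
e_0 = 0. -/
theorem armExcess_succ (hx : 2 ≤ x) (i : ℕ) (h : armExcess x i < x ^ 2 - 1) :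
    armExcess x (i + 1) = (1 + armExcess x i) / (x ^ 2 - 1 - armExcess x i) := by
  have h3 := (pathEval_succ_pos hx (i + 2)).ne'
  have e := mul_pathEval_div hx i
  have e' : x * pathEval x (i + 1) = (1 + armExcess x i) * pathEval x (i + 2) := by
    rw [← e]
    field_simp [(pathEval_succ_pos hx (i + 1)).ne']
  have hx0 : x ≠ 0 := by positivity
  rw [armExcess, div_eq_div_iff h3 (by linarith)]
  refine mul_left_cancel₀ hx0 ?_
  rw [pathEval_add_two x (i + 1)]
  linear_combination (x ^ 2) * e'

/-- The quadratic condition says that the map sends U to at most U, so U bounds the whole orbit of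
0. -/
theorem armExcess_lt {U : ℝ} (hx : 2 ≤ x) (h0 : 0 < U) (h1 : U ≤ 1)
    (hU : U ^ 2 - (x ^ 2 - 2) * U + 1 ≤ 0) (i : ℕ) :
    0 ≤ armExcess x i ∧ armExcess x i < U := by
  induction i with
  | zero => rw [armExcess_zero]; exact ⟨le_rfl, h0⟩
  | succ i ih =>
    have : armExcess x i < x ^ 2 - 1 := by nlinarith
    rw [armExcess_succ hx i this]
    have hp : 0 < x ^ 2 - 1 - armExcess x i := by linarith
    refine ⟨div_nonneg (by linarith) hp.le, ?_⟩
    rw [div_lt_iff₀ hp]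
    nlinarith

theorem armExcess_lt_inv (hx : 2 ≤ x) (i : ℕ) :
    0 ≤ armExcess x i ∧ armExcess x i < 1 / (x ^ 2 - 3) := by
  have h : 1 ≤ x ^ 2 - 3 := by nlinarith
  refine armExcess_lt hx (by positivity) ((div_le_one (by linarith)).2 h) ?_ i
  have hp : x ^ 2 - 3 ≠ 0 := by linarith
  have : (1 / (x ^ 2 - 3)) ^ 2 - (x ^ 2 - 2) * (1 / (x ^ 2 - 3)) + 1 =
      -((x ^ 2 - 3 - 1) / (x ^ 2 - 3) ^ 2) := by
    field_simp
    ring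
  rw [this, neg_nonpos]
  exact div_nonneg (by linarith) (by positivity)

theorem armExcess_lt_one (hx : 2 ≤ x) (i : ℕ) : armExcess x i < 1 :=
  (armExcess_lt_inv hx i).2.trans_le ((div_le_one (by nlinarith)).2 (by nlinarith))

theorem armExcess_strictMono (hx : 2 ≤ x) : StrictMono (armExcess x) := by
  refine strictMono_nat_of_lt_succ fun i => ?_
  have hlt : ∀ j, armExcess x j < x ^ 2 - 1 := fun j => by
    have := armExcess_lt_one hx j
    nlinarith
  induction i with
  | zero =>
    rw [armExcess_succ hx 0 (hlt 0), armExcess_zero]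
    exact div_pos (by norm_num) (by nlinarith)
  | succ i ih =>
    rw [armExcess_succ hx (i + 1) (hlt _)]
    nth_rewrite 1 [armExcess_succ hx i (hlt _)]
    have h0 := (armExcess_lt_inv hx i).1
    have h1 := hlt i
    have h2 := hlt (i + 1)
    rw [div_lt_div_iff₀ (by linarith) (by linarith)]
    nlinarith

theorem armExcess_values {D : ℝ} (hx : 2 ≤ x) (hD : x ^ 2 = D + 1) :
    armExcess x 1 = 1 / D ∧ armExcess x 2 = 1 / (D - 1) ∧
      armExcess x 3 = D / (D ^ 2 - D - 1) ∧ armExcess x 4 = (D - 1) / (D * (D - 2)) := by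
  have hlt : ∀ j, armExcess x j < x ^ 2 - 1 := fun j => by
    have := armExcess_lt_one hx j
    nlinarith
  have h3 : 3 ≤ D := by nlinarith
  have hd0 : D ≠ 0 := by positivity
  have hd1 : D - 1 ≠ 0 := by linarith
  have hd2 : D - 2 ≠ 0 := by linarith
  have hq : D ^ 2 - D - 1 ≠ 0 := by nlinarith
  have e1 : armExcess x 1 = 1 / D := by
    rw [armExcess_succ hx 0 (hlt 0), armExcess_zero, hD]; ring
  have e2 : armExcess x 2 = 1 / (D - 1) := by
    have : D + 1 - 1 - 1 / D ≠ 0 := by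
      have := hlt 1; rw [e1, hD] at this; linarith
    rw [armExcess_succ hx 1 (hlt 1), e1, hD, div_eq_div_iff this hd1]
    field_simp
    ring
  have e3 : armExcess x 3 = D / (D ^ 2 - D - 1) := by
    have : D + 1 - 1 - 1 / (D - 1) ≠ 0 := by
      have := hlt 2; rw [e2, hD] at this; linarith
    rw [armExcess_succ hx 2 (hlt 2), e2, hD, div_eq_div_iff this hq]
    field_simp
    ring
  refine ⟨e1, e2, e3, ?_⟩
  have : D + 1 - 1 - D / (D ^ 2 - D - 1) ≠ 0 := by
    have := hlt 3; rw [e3, hD] at this; linarith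
  rw [armExcess_succ hx 3 (hlt 3), e3, hD, div_eq_div_iff this (mul_ne_zero hd0 hd2)]
  obtain ⟨q, hqD⟩ : ∃ q, q = D ^ 2 - D - 1 := ⟨_, rfl⟩
  rw [← hqD] at hq ⊢
  field_simp
  rw [hqD]
  ring

/-- A fixed point satisfies e = 1/(D - 1 - e). Applying U ↦ 1/(D - 1 - U) twice to the bound 1/(D -
2) gives this fraction. Neither 1/(D - 2) nor its first image is sharp enough for the final count:
both fail at D = 4. -/
theorem armExcess_lt_of_sq_eq {D : ℝ} (hx : 2 ≤ x) (hD : x ^ 2 = D + 1) (i : ℕ) :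
    armExcess x i < (D ^ 2 - 3 * D + 1) / (D ^ 3 - 4 * D ^ 2 + 3 * D + 1) := by
  -- x ≥ 2 means D ≥ 3; in s, numerator and denominator have only positive coefficients.
  obtain ⟨s, hs, rfl⟩ : ∃ s : ℝ, 0 ≤ s ∧ D = 3 + s := ⟨D - 3, by nlinarith, by ring⟩
  have hE : 0 < (3 + s) ^ 3 - 4 * (3 + s) ^ 2 + 3 * (3 + s) + 1 := by
    ring_nf; positivity
  have hP : 0 < (3 + s) ^ 2 - 3 * (3 + s) + 1 := by
    ring_nf; positivity
  refine (armExcess_lt hx (div_pos hP hE) ((div_le_one hE).2 ?_) ?_ i).2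
  · nlinarith [mul_nonneg hs hs, mul_nonneg hs (mul_nonneg hs hs)]
  · rw [hD]
    have : ((((3 + s) ^ 2 - 3 * (3 + s) + 1) /
        ((3 + s) ^ 3 - 4 * (3 + s) ^ 2 + 3 * (3 + s) + 1)) ^ 2 -
        (3 + s + 1 - 2) * (((3 + s) ^ 2 - 3 * (3 + s) + 1) /
        ((3 + s) ^ 3 - 4 * (3 + s) ^ 2 + 3 * (3 + s) + 1)) + 1) =
        -(s / ((3 + s) ^ 3 - 4 * (3 + s) ^ 2 + 3 * (3 + s) + 1) ^ 2) := by
      obtain ⟨q, hq⟩ : ∃ q, q = (3 + s) ^ 3 - 4 * (3 + s) ^ 2 + 3 * (3 + s) + 1 := ⟨_, rfl⟩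
      rw [← hq] at hE ⊢
      have := hE.ne'
      field_simp
      rw [hq]
      ring
    rw [this, neg_nonpos]
    positivity

end Excess

/-! ### Which arm counts have total excess 1 -/

theorem sum_natCast_mul_lt {ι : Type*} (s : Finset ι) (N : ι → ℕ) (u : ι → ℝ) {U : ℝ}
    (hu : ∀ i ∈ s, u i < U) (hN : ∑ i ∈ s, N i ≠ 0) :
    ∑ i ∈ s, N i * u i < (∑ i ∈ s, N i : ℕ) * U := by
  obtain ⟨i, hi, hi0⟩ := Finset.exists_ne_zero_of_sum_ne_zero hN
  push_cast
  rw [Finset.sum_mul]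
  refine Finset.sum_lt_sum (fun j hj => ?_) ⟨i, hi, ?_⟩
  · exact mul_le_mul_of_nonneg_left (hu j hj).le (Nat.cast_nonneg _)
  · exact mul_lt_mul_of_pos_left (hu i hi) (by positivity)

theorem lt_sum_natCast_mul {ι : Type*} (s : Finset ι) (N : ι → ℕ) (u : ι → ℝ) {U : ℝ}
    (hu : ∀ i ∈ s, U < u i) (hN : ∑ i ∈ s, N i ≠ 0) :
    (∑ i ∈ s, N i : ℕ) * U < ∑ i ∈ s, N i * u i := by
  have := sum_natCast_mul_lt s N (fun i => -u i) (U := -U) (fun i hi => neg_lt_neg (hu i hi)) hN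
  simp only [mul_neg, Finset.sum_neg_distrib] at this
  linarith

/-- D is the degree of the center; m, a, b, f, g count the arms with 1, 2, 3, 4, 5 vertices; R and S
are the number and total excess of the longer ones. -/
theorem arm_counts_of_sum_eq_one {D S : ℝ} (hD : 3 ≤ D) {m a b f g R : ℕ}
    (hn : (m + a + b + f + g + R : ℝ) = D)
    (hS : a * (1 / D) + b * (1 / (D - 1)) + f * (D / (D ^ 2 - D - 1)) +
      g * ((D - 1) / (D * (D - 2))) + S = 1)
    (hR0 : R = 0 → S = 0) (hR1 : R ≠ 0 → R * ((D - 1) / (D * (D - 2))) < S)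
    (hR2 : R ≠ 0 → S < R * ((D ^ 2 - 3 * D + 1) / (D ^ 3 - 4 * D ^ 2 + 3 * D + 1))) :
    (m = 0 ∧ b = 0 ∧ f = 0 ∧ g = 0 ∧ R = 0) ∨ (m = 1 ∧ a = 0 ∧ f = 0 ∧ g = 0 ∧ R = 0) ∨
      (m = 1 ∧ a = 1 ∧ b = 0 ∧ f = 0 ∧ R = 0) := by
  obtain ⟨s, hs, rfl⟩ : ∃ s : ℝ, 0 ≤ s ∧ D = 3 + s := ⟨D - 3, by linarith, by ring⟩
  have hE : 0 < (3 + s) ^ 3 - 4 * (3 + s) ^ 2 + 3 * (3 + s) + 1 := by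
    ring_nf; positivity
  have hQ : 0 < (3 + s) ^ 2 - (3 + s) - 1 := by
    ring_nf; positivity
  have hd1 : 0 < 3 + s - 1 := by linarith
  have hd2 : 0 < 3 + s - 2 := by linarith
  have h12 : 1 / (3 + s) < 1 / (3 + s - 1) := by
    rw [div_lt_div_iff₀ (by positivity) hd1]; linarith
  have h23 : 1 / (3 + s - 1) < (3 + s) / ((3 + s) ^ 2 - (3 + s) - 1) := by
    rw [div_lt_div_iff₀ hd1 hQ]; nlinarith
  have h34 : (3 + s) / ((3 + s) ^ 2 - (3 + s) - 1) < (3 + s - 1) / ((3 + s) * (3 + s - 2)) := by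
    rw [div_lt_div_iff₀ hQ (by positivity)]; nlinarith
  have h4U : (3 + s - 1) / ((3 + s) * (3 + s - 2)) <
      ((3 + s) ^ 2 - 3 * (3 + s) + 1) / ((3 + s) ^ 3 - 4 * (3 + s) ^ 2 + 3 * (3 + s) + 1) := by
    rw [div_lt_div_iff₀ (by positivity) hE]; nlinarith
  have hU : ((3 + s) ^ 2 - 3 * (3 + s) + 1) / ((3 + s) ^ 3 - 4 * (3 + s) ^ 2 + 3 * (3 + s) + 1)
      ≤ 1 / (3 + s - 2) := by
    rw [div_le_div_iff₀ hE hd2]; nlinarith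
  have k1 : (3 + s) * (1 / (3 + s)) = 1 := by field_simp
  have k2 : (3 + s - 1) * (1 / (3 + s - 1)) = 1 := by field_simp
  have k3 : (3 + s - 2) * (1 / (3 + s - 2)) = 1 := by field_simp
  have k4 : 1 / (3 + s) + (3 + s - 2) * ((3 + s - 1) / ((3 + s) * (3 + s - 2))) = 1 := by
    field_simp
    ring
  -- One arm of 2 vertices, one of 4, and D - 3 arms at the upper bound still fall short of 1; the
  -- margin is the explicit fraction in `e`.
  have k5 : 1 / (3 + s) + (3 + s) / ((3 + s) ^ 2 - (3 + s) - 1) + s * (((3 + s) ^ 2 -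
      3 * (3 + s) + 1) / ((3 + s) ^ 3 - 4 * (3 + s) ^ 2 + 3 * (3 + s) + 1)) < 1 := by
    have e : 1 - (1 / (3 + s) + (3 + s) / ((3 + s) ^ 2 - (3 + s) - 1) + s * (((3 + s) ^ 2 -
      3 * (3 + s) + 1) / ((3 + s) ^ 3 - 4 * (3 + s) ^ 2 + 3 * (3 + s) + 1))) =
      1 / ((3 + s) * ((3 + s) ^ 2 - (3 + s) - 1) *
        ((3 + s) ^ 3 - 4 * (3 + s) ^ 2 + 3 * (3 + s) + 1)) := by
      obtain ⟨q, hq⟩ : ∃ q, q = (3 + s) ^ 3 - 4 * (3 + s) ^ 2 + 3 * (3 + s) + 1 := ⟨_, rfl⟩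
      obtain ⟨r, hr⟩ : ∃ r, r = (3 + s) ^ 2 - (3 + s) - 1 := ⟨_, rfl⟩
      rw [← hq] at hE ⊢
      rw [← hr] at hQ ⊢
      have := hE.ne'
      have := hQ.ne'
      field_simp
      rw [hq, hr]
      ring
    have : 0 < 1 / ((3 + s) * ((3 + s) ^ 2 - (3 + s) - 1) *
        ((3 + s) ^ 3 - 4 * (3 + s) ^ 2 + 3 * (3 + s) + 1)) :=
      div_pos (by positivity) (by positivity)
    linarith
  have v1 : 0 < 1 / (3 + s) := by positivity
  -- From here on only the order w1 < w2 < v3 < v4 < U ≤ w3 and the relations `k1` to `k5` matter.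
  generalize 1 / (3 + s) = w1 at *
  generalize 1 / (3 + s - 1) = w2 at *
  generalize 1 / (3 + s - 2) = w3 at *
  generalize (3 + s) / ((3 + s) ^ 2 - (3 + s) - 1) = v3 at *
  generalize (3 + s - 1) / ((3 + s) * (3 + s - 2)) = v4 at *
  generalize ((3 + s) ^ 2 - 3 * (3 + s) + 1) / ((3 + s) ^ 3 - 4 * (3 + s) ^ 2 + 3 * (3 + s) + 1)
    = U at *
  have hSl : R * v4 ≤ S := by
    by_cases h : R = 0
    · rw [h, hR0 h]; simp
    · exact (hR1 h).le
  have hSu : S ≤ R * U := by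
    by_cases h : R = 0
    · rw [h, hR0 h]; simp
    · exact (hR2 h).le
  have pos : ∀ (t : ℕ) (y : ℝ), 0 < y → 0 ≤ t * y := fun t y hy => by positivity
  have zero : ∀ (t : ℕ) (y : ℝ), 0 < y → t * y ≤ 0 → t = 0 := fun t y hy h => by
    by_contra ht
    have : 0 < (t : ℝ) * y := by positivity
    linarith
  rcases Nat.lt_or_ge m 2 with hm | hm
  · interval_cases m
    -- D arms of excess at least w1 = 1/D have sum 1, so each has excess exactly w1.
    · left
      push_cast at hn
      have tot : b * (w2 - w1) + f * (v3 - w1) + g * (v4 - w1) + R * (v4 - w1) ≤ 0 := by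
        have : (3 + s) * w1 = (a + b + f + g + R) * w1 := by rw [← hn]; ring
        linarith
      have p1 := pos b (w2 - w1) (by linarith)
      have p2 := pos f (v3 - w1) (by linarith)
      have p3 := pos g (v4 - w1) (by linarith)
      have p4 := pos R (v4 - w1) (by linarith)
      exact ⟨rfl, zero b (w2 - w1) (by linarith) (by linarith), zero f (v3 - w1) (by linarith) (by linarith),
        zero g (v4 - w1) (by linarith) (by linarith), zero R (v4 - w1) (by linarith) (by linarith)⟩
    · right
      push_cast at hn
      rcases Nat.eq_zero_or_pos a with ha | ha
      -- Likewise for D - 1 arms of excess at least w2 = 1/(D - 1).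
      · left
        subst ha
        push_cast at hn hS
        have tot : f * (v3 - w2) + g * (v4 - w2) + R * (v4 - w2) ≤ 0 := by
          have : (3 + s - 1) * w2 = (b + f + g + R) * w2 := by rw [← hn]; ring
          linarith
        have p2 := pos f (v3 - w2) (by linarith)
        have p3 := pos g (v4 - w2) (by linarith)
        have p4 := pos R (v4 - w2) (by linarith)
        exact ⟨rfl, rfl, zero f (v3 - w2) (by linarith) (by linarith),
          zero g (v4 - w2) (by linarith) (by linarith), zero R (v4 - w2) (by linarith) (by linarith)⟩
      · right
        obtain ⟨a, rfl⟩ := Nat.exists_eq_add_of_le' ha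
        push_cast at hn hS
        -- Apart from one arm of 1 vertex and one of 2, D - 2 arms remain, and by `k4` their average
        -- excess is v4. So either all have 5 vertices or one of them has fewer.
        by_cases hz : a + b + f = 0
        · obtain ⟨rfl, rfl, rfl⟩ : a = 0 ∧ b = 0 ∧ f = 0 := by omega
          refine ⟨rfl, rfl, rfl, rfl, ?_⟩
          by_contra hR
          have h1 := hR1 hR
          have : (3 + s - 2) * v4 = (g + R) * v4 := by rw [← hn]; push_cast; ring
          push_cast at hS
          linarith
        -- Some remaining arm has excess at most v3 and the other s = D - 3 have at most U,
        -- contradicting `k5`.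
        · exfalso
          have hz' : (1 : ℝ) ≤ a + b + f := by exact_mod_cast Nat.one_le_iff_ne_zero.2 hz
          have p1 := pos a (v3 - w1) (by linarith)
          have p2 := pos b (v3 - w2) (by linarith)
          have p3 := pos g (U - v4) (by linarith)
          have p4 : 0 ≤ (a + b + f - 1) * (U - v3) :=
            mul_nonneg (by linarith) (by linarith)
          have : s * U = (a + b + f - 1 + g + R) * U := by
            congr 1; linarith
          linarith
  -- At most D - 2 arms have nonzero excess, each below w3 = 1/(D - 2). A sum of 1 would leave no
  -- such arm, and then the sum is 0.
  · exfalso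
    have hm' : (2 : ℝ) ≤ m := by exact_mod_cast hm
    have p0 : 0 ≤ (m - 2) * w3 := mul_nonneg (by linarith) (by linarith)
    have p1 := pos a (w3 - w1) (by linarith)
    have p2 := pos b (w3 - w2) (by linarith)
    have p3 := pos f (w3 - v3) (by linarith)
    have p4 := pos g (w3 - v4) (by linarith)
    have p5 : 0 ≤ (R : ℝ) * (w3 - U) := mul_nonneg (by positivity) (by linarith)
    have e : (3 + s - 2) * w3 = (m - 2 + a + b + f + g + R) * w3 := by rw [← hn]; ring
    have z1 := zero a (w3 - w1) (by linarith) (by linarith)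
    have z2 := zero b (w3 - w2) (by linarith) (by linarith)
    have z3 := zero f (w3 - v3) (by linarith) (by linarith)
    have z4 := zero g (w3 - v4) (by linarith) (by linarith)
    have z5 : R = 0 := by
      by_contra hR
      have := hR2 hR
      linarith
    have z6 := hR0 z5
    subst z1 z2 z3 z4
    simp [z6] at hS

/-! ### From the eigenvalue √c to the tree -/

section Forward
variable {k : ℕ}

/-- The number of arms with `i + 1` vertices, for every natural number `i`. -/
def armCount (n : Fin k → ℕ) (i : ℕ) : ℕ := if hi : i < k then n ⟨i, hi⟩ else 0

theorem sum_mul_eq_sum_armCount (n : Fin k → ℕ) (w : ℕ → ℝ) :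
    ∑ i, (n i : ℝ) * w i = ∑ t ∈ Finset.range (5 + k), (armCount n t : ℝ) * w t := by
  have h : ∀ i : Fin k, (n i : ℝ) * w i = armCount n i * w i := fun i => by
    rw [armCount, dif_pos i.2]
  rw [Finset.sum_congr rfl fun i _ => h i,
    Fin.sum_univ_eq_sum_range fun t => (armCount n t : ℝ) * w t]
  -- The range is padded to 5 + k so that the first five terms can be split off even when k < 5.
  refine Finset.sum_subset (Finset.range_subset_range.2 (by omega)) fun t _ ht => ?_
  rw [armCount, dif_neg (by simpa using ht)]
  simp

theorem sum_mul_eq_five_add_tail (n : Fin k → ℕ) (w : ℕ → ℝ) :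
    ∑ i, (n i : ℝ) * w i = armCount n 0 * w 0 + armCount n 1 * w 1 + armCount n 2 * w 2 +
      armCount n 3 * w 3 + armCount n 4 * w 4 +
      ∑ t ∈ Finset.range k, (armCount n (5 + t) : ℝ) * w (5 + t) := by
  rw [sum_mul_eq_sum_armCount, Finset.sum_range_add]
  simp [Finset.sum_range_succ]

theorem armCount_eq_zero_of_tail {n : Fin k → ℕ}
    (h : ∑ t ∈ Finset.range k, armCount n (5 + t) = 0) {i : ℕ} (hi : 5 ≤ i) :
    armCount n i = 0 := by
  obtain ⟨t, rfl⟩ := Nat.exists_eq_add_of_le hi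
  by_cases ht : t < k
  · exact (Finset.sum_eq_zero_iff.1 h) t (Finset.mem_range.2 ht)
  · rw [armCount, dif_neg (by omega)]

theorem sum_armExcess_eq {x : ℝ} (hx : 2 ≤ x) (n : Fin k → ℕ)
    (h : aeval x (graphCharpoly (starlikeTree n)) = 0) :
    ∑ i, n i * armExcess x i = x ^ 2 - (∑ i, n i : ℕ) := by
  rw [aeval_graphCharpoly_starlikeTree hx, mul_eq_zero] at h
  rcases h with h | h
  · have e : x ^ 2 = ∑ i, n i * (1 + armExcess x i) := by
      rw [sq]
      nth_rewrite 2 [sub_eq_zero.1 h]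
      rw [Finset.mul_sum]
      refine Finset.sum_congr rfl fun i _ => ?_
      rw [← mul_pathEval_div hx]
      ring
    rw [e]
    simp [mul_add, Finset.sum_add_distrib]
  · refine absurd h (Finset.prod_ne_zero_iff.2 fun i _ => pow_ne_zero _ ?_)
    exact (pathEval_succ_pos hx _).ne'

/-- With 0 ≤ e_i < 1/(c - 3), the integer c - d is nonnegative and (c - d)(c - 3) < d. If c ≥ d + 2,
the left side is at least (d - 1) + 1, since c ≥ 4. -/
theorem degree_eq_or_of_sum_armExcess {x : ℝ} (hx : 2 ≤ x) {c : ℤ} (hc : 4 ≤ c)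
    (hxc : x ^ 2 = c) (n : Fin k → ℕ)
    (h : ∑ i, n i * armExcess x i = x ^ 2 - (∑ i, n i : ℕ)) :
    c = (∑ i, n i : ℕ) ∨ c = (∑ i, n i : ℕ) + 1 := by
  have hc' : (4 : ℝ) ≤ c := by exact_mod_cast hc
  have h0 : 0 ≤ ∑ i, n i * armExcess x i :=
    Finset.sum_nonneg fun i _ => mul_nonneg (Nat.cast_nonneg _) (armExcess_lt_inv hx i).1
  have hd : ∑ i, n i ≠ 0 := by
    intro hd
    have : ∑ i, n i * armExcess x i = 0 := Finset.sum_eq_zero fun i hi => by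
      rw [(Finset.sum_eq_zero_iff.1 hd) i hi]; simp
    rw [hd] at h
    push_cast at h
    linarith
  have h1 := sum_natCast_mul_lt Finset.univ n (fun i => armExcess x i)
    (fun i _ => (armExcess_lt_inv hx i).2) hd
  rw [h, hxc, mul_one_div, lt_div_iff₀ (by linarith)] at h1
  rw [h, hxc] at h0
  generalize ∑ i, n i = d at *
  have h0' : (d : ℤ) ≤ c := by
    have : (d : ℝ) ≤ c := by linarith
    exact_mod_cast this
  have h1' : (c - d) * (c - 3) < (d : ℤ) := by exact_mod_cast h1
  by_contra! hne
  have : (d : ℤ) + 2 ≤ c := by omega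
  nlinarith

theorem starlikeTree_cases_of_eigenvalue {c : ℤ} (hc : 4 ≤ c) {x : ℝ} (hx : 2 ≤ x)
    (hxc : x ^ 2 = c) (n : Fin k → ℕ) (h : aeval x (graphCharpoly (starlikeTree n)) = 0) :
    (∃ n₅ : ℕ, 1 ≤ n₅ ∧ Nonempty (starlikeTree n ≃g starlikeTree ![1, 1, 0, 0, n₅])) ∨
      (∃ n₃ : ℕ, 2 ≤ n₃ ∧ Nonempty (starlikeTree n ≃g starlikeTree ![1, 0, n₃])) ∨
      (∃ n₂ : ℕ, 3 ≤ n₂ ∧ Nonempty (starlikeTree n ≃g starlikeTree ![0, n₂])) ∨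
      (∃ n₁ : ℕ, 4 ≤ n₁ ∧ Nonempty (starlikeTree n ≃g starlikeTree ![n₁])) := by
  have hsum := sum_armExcess_eq hx n h
  have hdeg := degree_eq_or_of_sum_armExcess hx hc hxc n hsum
  have hcount := sum_mul_eq_five_add_tail n fun _ => 1
  simp only [mul_one] at hcount
  have hmono := armExcess_strictMono hx
  have htail : ∑ t ∈ Finset.range k, armCount n (5 + t) ≠ 0 →
      ((∑ t ∈ Finset.range k, armCount n (5 + t) : ℕ) : ℝ) * armExcess x 4 <
        ∑ t ∈ Finset.range k, (armCount n (5 + t) : ℝ) * armExcess x (5 + t) := fun hR =>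
    lt_sum_natCast_mul _ (fun t => armCount n (5 + t)) (fun t => armExcess x (5 + t))
      (fun t _ => hmono (by omega)) hR
  have htail0 : ∑ t ∈ Finset.range k, armCount n (5 + t) = 0 →
      ∑ t ∈ Finset.range k, (armCount n (5 + t) : ℝ) * armExcess x (5 + t) = 0 := fun hR =>
    Finset.sum_eq_zero fun t ht => by rw [(Finset.sum_eq_zero_iff.1 hR) t ht]; simp
  have htailU := fun hD : x ^ 2 = ((∑ i, n i : ℕ) : ℝ) + 1 => fun hR =>
    sum_natCast_mul_lt (Finset.range k) (fun t => armCount n (5 + t))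
      (fun t => armExcess x (5 + t)) (fun t _ => armExcess_lt_of_sq_eq hx hD (5 + t)) hR
  rw [sum_mul_eq_five_add_tail, armExcess_zero] at hsum
  have hzero : ∑ t ∈ Finset.range k, armCount n (5 + t) = 0 → ∀ i, 5 ≤ i → armCount n i = 0 :=
    fun hR i hi => armCount_eq_zero_of_tail hR hi
  have hiso : ∀ {l : ℕ} (p : Fin l → ℕ), (∀ i, armCount n i = armCount p i) →
      Nonempty (starlikeTree n ≃g starlikeTree p) := fun p hp => starlikeTree_iso_of_counts n p hp
  rw [← Nat.cast_sum, ← Nat.cast_sum] at hcount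
  generalize hS : ∑ t ∈ Finset.range k, (armCount n (5 + t) : ℝ) * armExcess x (5 + t) = S at *
  generalize hR : ∑ t ∈ Finset.range k, armCount n (5 + t) = R at *
  generalize hd : ∑ i, n i = d at *
  have hcount' : d = armCount n 0 + armCount n 1 + armCount n 2 + armCount n 3 + armCount n 4 +
      R := by exact_mod_cast hcount
  rcases hdeg with hdeg | hdeg
  -- Case c = d: the total excess is 0, while every arm with at least 2 vertices has positive
  -- excess.
  · have hp : ∀ i, 0 < armExcess x (i + 1) := fun i =>
      (armExcess_zero x).symm.trans_lt (hmono (Nat.succ_pos i))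
    have hnn : ∀ t i, 0 ≤ (armCount n t : ℝ) * armExcess x (i + 1) := fun t i =>
      mul_nonneg (Nat.cast_nonneg _) (hp i).le
    have hz : ∀ t i, (armCount n t : ℝ) * armExcess x (i + 1) ≤ 0 → armCount n t = 0 := by
      intro t i hle
      by_contra ht
      have := mul_pos (show (0 : ℝ) < armCount n t by positivity) (hp i)
      linarith
    have hxd : x ^ 2 = d := by rw [hxc, hdeg]; simp
    have hS0 : 0 ≤ S := by
      by_cases h : R = 0
      · rw [htail0 h]
      · exact (mul_nonneg (Nat.cast_nonneg _) (hp 3).le).trans (htail h).le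
    have q1 := hnn 1 0
    have q2 := hnn 2 1
    have q3 := hnn 3 2
    have q4 := hnn 4 3
    norm_num at q1 q2 q3 q4
    have z1 := hz 1 0 (by norm_num; linarith)
    have z2 := hz 2 1 (by norm_num; linarith)
    have z3 := hz 3 2 (by norm_num; linarith)
    have z4 := hz 4 3 (by norm_num; linarith)
    have zR : R = 0 := by
      by_contra hR0
      have h1 := htail hR0
      have h2 : 0 ≤ (R : ℝ) * armExcess x 4 := mul_nonneg (Nat.cast_nonneg _) (hp 3).le
      linarith
    refine Or.inr (Or.inr (Or.inr ⟨armCount n 0, by omega, hiso _ fun i => ?_⟩))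
    rcases Nat.lt_or_ge i 5 with hi | hi
    · interval_cases i <;> simp [*] <;> simp [armCount]
    · rw [hzero zR i hi, armCount, dif_neg (by omega)]
  -- Case c = d + 1: the total excess is 1, and c ≥ 4 gives d ≥ 3, whence the lower bounds on n₂, n₃
  -- and n₅.
  · have hxd : x ^ 2 = (d : ℝ) + 1 := by rw [hxc, hdeg]; simp
    have hd3 : (3 : ℝ) ≤ d := by
      have : 3 ≤ d := by omega
      exact_mod_cast this
    obtain ⟨e1, e2, e3, e4⟩ := armExcess_values hx hxd
    rw [e1, e2, e3, e4] at hsum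
    rw [e4] at htail
    have hcases := arm_counts_of_sum_eq_one hd3 (m := armCount n 0) (a := armCount n 1)
      (b := armCount n 2) (f := armCount n 3) (g := armCount n 4) (R := R) (S := S)
      (by rw [hcount']; push_cast; ring) (by linarith) htail0 htail (htailU hxd)
    have hd3' : 3 ≤ d := by exact_mod_cast hd3
    rcases hcases with ⟨z0, z2, z3, z4, zR⟩ | ⟨z0, z1, z3, z4, zR⟩ | ⟨z0, z1, z2, z3, zR⟩
    · refine Or.inr (Or.inr (Or.inl ⟨armCount n 1, by omega, hiso _ fun i => ?_⟩))
      rcases Nat.lt_or_ge i 5 with hi | hi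
      · interval_cases i <;> simp [*] <;> simp [armCount]
      · rw [hzero zR i hi, armCount, dif_neg (by omega)]
    · refine Or.inr (Or.inl ⟨armCount n 2, by omega, hiso _ fun i => ?_⟩)
      rcases Nat.lt_or_ge i 5 with hi | hi
      · interval_cases i <;> simp [*] <;> simp [armCount]
      · rw [hzero zR i hi, armCount, dif_neg (by omega)]
    · refine Or.inl ⟨armCount n 4, by omega, hiso _ fun i => ?_⟩
      rcases Nat.lt_or_ge i 5 with hi | hi
      · interval_cases i <;> simp [*] <;> simp [armCount]
      · rw [hzero zR i hi, armCount, dif_neg (by omega)]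

end Forward

theorem mainTheorem2 :
    (∀ (V : Type*) [Fintype V] (T : SimpleGraph V),
      IsStarlikeTree T → ProperlyContainsClaw T → IsQuadraticGraph T →
        (HasFormI T ↔
          (∃ n₅ : ℕ, 1 ≤ n₅ ∧ Nonempty (T ≃g starlikeTree ![1, 1, 0, 0, n₅])) ∨
          (∃ n₃ : ℕ, 2 ≤ n₃ ∧ Nonempty (T ≃g starlikeTree ![1, 0, n₃])) ∨
          (∃ n₂ : ℕ, 3 ≤ n₂ ∧ Nonempty (T ≃g starlikeTree ![0, n₂])) ∨
          (∃ n₁ : ℕ, 4 ≤ n₁ ∧ Nonempty (T ≃g starlikeTree ![n₁])))) ∧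
    (∀ n₅ : ℕ, 1 ≤ n₅ →
      ProperlyContainsClaw (starlikeTree ![1, 1, 0, 0, n₅]) ∧
      IsQuadraticGraph (starlikeTree ![1, 1, 0, 0, n₅]) ∧
      graphCharpoly (starlikeTree ![1, 1, 0, 0, n₅]) =
        X ^ n₅ * (X ^ 2 - 1) ^ n₅ * (X ^ 2 - X - 1) * (X ^ 2 + X - 1) *
          (X ^ 2 - 3) ^ (n₅ - 1) * (X ^ 2 - C ((n₅ : ℤ) + 3))) ∧
    (∀ n₃ : ℕ, 2 ≤ n₃ →
      ProperlyContainsClaw (starlikeTree ![1, 0, n₃]) ∧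
      IsQuadraticGraph (starlikeTree ![1, 0, n₃]) ∧
      graphCharpoly (starlikeTree ![1, 0, n₃]) =
        X ^ n₃ * (X ^ 2 - 1) * (X ^ 2 - 2) ^ (n₃ - 1) * (X ^ 2 - C ((n₃ : ℤ) + 2))) ∧
    (∀ n₂ : ℕ, 3 ≤ n₂ →
      ProperlyContainsClaw (starlikeTree ![0, n₂]) ∧
      IsQuadraticGraph (starlikeTree ![0, n₂]) ∧
      graphCharpoly (starlikeTree ![0, n₂]) =
        X * (X ^ 2 - 1) ^ (n₂ - 1) * (X ^ 2 - C ((n₂ : ℤ) + 1))) ∧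
    (∀ n₁ : ℕ, 4 ≤ n₁ →
      ProperlyContainsClaw (starlikeTree ![n₁]) ∧
      IsQuadraticGraph (starlikeTree ![n₁]) ∧
      graphCharpoly (starlikeTree ![n₁]) =
        X ^ (n₁ - 1) * (X ^ 2 - C (n₁ : ℤ))) := by
  refine ⟨fun V _ T hT _ _ => ⟨?_, ?_⟩, fun a ha => ?_, fun a ha => ?_, fun a ha => ?_,
    fun a ha => ?_⟩
  · rintro ⟨c, t₁, t₂, t₃, t₄, t₅, hc, hp, -⟩
    obtain ⟨k, n, ⟨e⟩⟩ := hT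
    have hc' : (4 : ℝ) ≤ c := by exact_mod_cast hc
    have hs : √(c : ℝ) ^ 2 = c := Real.sq_sqrt (by linarith)
    have hroot : aeval √(c : ℝ) (graphCharpoly (starlikeTree n)) = 0 := by
      rw [← graphCharpoly_congr e, hp, map_mul]
      simp [hs]
    have := starlikeTree_cases_of_eigenvalue hc (Real.le_sqrt_of_sq_le (by linarith)) hs n hroot
    exact this.imp (fun ⟨a, ha, ⟨g⟩⟩ => ⟨a, ha, ⟨e.trans g⟩⟩)
      (Or.imp (fun ⟨a, ha, ⟨g⟩⟩ => ⟨a, ha, ⟨e.trans g⟩⟩)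
      (Or.imp (fun ⟨a, ha, ⟨g⟩⟩ => ⟨a, ha, ⟨e.trans g⟩⟩)
      (fun ⟨a, ha, ⟨g⟩⟩ => ⟨a, ha, ⟨e.trans g⟩⟩)))
  · rintro (⟨a, ha, ⟨e⟩⟩ | ⟨a, ha, ⟨e⟩⟩ | ⟨a, ha, ⟨e⟩⟩ | ⟨a, ha, ⟨e⟩⟩)
    · exact .of_iso e (hasFormI_of_charpoly_eq (by omega) (charpoly_arms_one_two_five_formI ha))
    · exact .of_iso e (hasFormI_of_charpoly_eq (by omega)
        (charpoly_arms_one_three_formI (by omega)))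
    · exact .of_iso e (hasFormI_of_charpoly_eq (by omega) (charpoly_arms_two_formI (by omega)))
    · exact .of_iso e (hasFormI_of_charpoly_eq (by omega) (charpoly_star_formI (by omega)))
  · exact ⟨properlyContainsClaw_arms_one_two_five ha,
      isQuadraticGraph_of_charpoly_eq (charpoly_arms_one_two_five_formI ha),
      graphCharpoly_arms_one_two_five ha⟩
  · exact ⟨properlyContainsClaw_arms_one_three ha,
      isQuadraticGraph_of_charpoly_eq (charpoly_arms_one_three_formI (by omega)),
      graphCharpoly_arms_one_three (by omega)⟩
  · exact ⟨properlyContainsClaw_arms_two ha,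
      isQuadraticGraph_of_charpoly_eq (charpoly_arms_two_formI (by omega)),
      graphCharpoly_arms_two (by omega)⟩
  · exact ⟨properlyContainsClaw_star ha,
      isQuadraticGraph_of_charpoly_eq (charpoly_star_formI (by omega)),
      graphCharpoly_star (by omega)⟩
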